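/- Let $r\ge 0$ be an integer, $n=r+2$, $N=2^n$, and index rows and columns of $N\times N$ matrices by $0,\dots,N-1$. Let $G_N=\begin{pmatrix}1&0\\1&1\end{pmatrix}^{\otimes n}$ over $\mathbb F_2$, with rows $g_0,\dots,g_{N-1}$, let $\mathrm w(\cdot)$ denote the Hamming weight, and let $\mathcal I$ be the $\mathrm{RM}(r,n)$ rate-profile, i.e. the set of $i\in\{0,\dots,N-1\}$ whose $n$-bit binary expansion has at least $n-r$ ones; put $\mathcal F=\{0,\dots,N-1\}\setminus\mathcal I$. Let $T\in\mathbb F_2^{N\times N}$ be any upper-triangular pre-transformation matrix, i.e. $t_{i,j}=0$ for $i>j$ and $t_{i,i}=1$ for $i\in\mathcal I$, and let $$\mathcal P(\mathcal I,T)=\{vTG_N : v\in\mathbb F_2^N,\ v_f=0 \text{ for all } f\in\mathcal F\}$$ be the corresponding pre-transformed polar code. Then its minimum distance is $d_{\min}=2^{n-r}$ $(=4)$, and the number of its codewords of weight $d_{\min}$ is exactly $$A_{d_{\min}}(\mathcal P(\mathcal I,T))=\frac{8\cdot 2^{3r}-6\cdot 2^{2r}+2^r}{3}.$$ Moreover,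 every minimum-weight coset is non-pre-transformable: for every $i\in\mathcal I$ with $\mathrm w(g_i)=d_{\min}$, there is no $f\in\mathcal F$ with $f>i$ and $\mathrm w(g_i+g_f)\neq \mathrm w(g_i)$. -/

import Mathlib

namespace PTPC

/-- The binary polar kernel. -/
def polarKernel : Matrix (Fin 2) (Fin 2) (ZMod 2) := !![1, 0; 1, 1]

/-- The polar transform matrix: the `n`-th Kronecker power of the kernel, with rows and columns
indexed by `0, …, 2 ^ n - 1`. The bijection `finProdFinEquiv` sends `(a, b)` to `a * 2 ^ n + b`,
so this is the usual block ordering of the Kronecker product. -/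
def polarMatrix : (n : ℕ) → Matrix (Fin (2 ^ n)) (Fin (2 ^ n)) (ZMod 2)
  | 0 => 1
  | n + 1 =>
    let e : Fin 2 × Fin (2 ^ n) ≃ Fin (2 ^ (n + 1)) :=
      finProdFinEquiv.trans (finCongr (pow_succ' 2 n).symm)
    Matrix.reindex e e (Matrix.kronecker polarKernel (polarMatrix n))

/-- The number of ones in the `n`-bit binary expansion of `i`. -/
def bitWeight (n : ℕ) (i : Fin (2 ^ n)) : ℕ :=
  ((Finset.range n).filter fun l => (i : ℕ).testBit l = true).card

/-- The Reed-Muller rate-profile of order `r`: the indices `i` with `bitWeight n i ≥ n - r`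
(the difference being taken in the integers). -/
def rmProfile (r n : ℕ) : Finset (Fin (2 ^ n)) :=
  Finset.univ.filter fun i => n ≤ bitWeight n i + r

/-- `T` is an upper-triangular pre-transformation matrix for the rate-profile `I`. -/
def IsPreTransform {n : ℕ} (I : Finset (Fin (2 ^ n)))
    (T : Matrix (Fin (2 ^ n)) (Fin (2 ^ n)) (ZMod 2)) : Prop :=
  (∀ i j, j < i → T i j = 0) ∧ ∀ i ∈ I, T i i = 1

/-- The pre-transformed polar code with rate-profile `I` and pre-transformation matrix `T`:
all words `v * T * G` where `v` vanishes on the frozen positions. -/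
def code {n : ℕ} (I : Finset (Fin (2 ^ n)))
    (T : Matrix (Fin (2 ^ n)) (Fin (2 ^ n)) (ZMod 2)) : Set (Fin (2 ^ n) → ZMod 2) :=
  {c | ∃ v : Fin (2 ^ n) → ZMod 2, (∀ f, f ∉ I → v f = 0) ∧
    c = Matrix.vecMul (Matrix.vecMul v T) (polarMatrix n)}

/-- The minimum Hamming distance between two different codewords. -/
noncomputable def minDist {N : ℕ} (C : Set (Fin N → ZMod 2)) : ℕ :=
  sInf {d | ∃ c ∈ C, ∃ c' ∈ C, c ≠ c' ∧ d = hammingDist c c'}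

/-- The number of codewords of Hamming weight `w`. -/
noncomputable def weightCount {N : ℕ} (C : Set (Fin N → ZMod 2)) (w : ℕ) : ℕ :=
  {c ∈ C | hammingNorm c = w}.ncard

/-- The indices in `I` of the cosets whose leader, a row of the polar matrix, has weight `w`. -/
def leaderIndices {n : ℕ} (I : Finset (Fin (2 ^ n))) (w : ℕ) : Finset (Fin (2 ^ n)) :=
  I.filter fun i => hammingNorm (polarMatrix n i) = w

/-- The set `K_i` of later rows that do not change the weight of row `i` when added to it. -/
def coreRows {n : ℕ} (i : Fin (2 ^ n)) : Finset (Fin (2 ^ n)) :=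
  (Finset.Ioi i).filter fun j =>
    hammingNorm (polarMatrix n i + polarMatrix n j) = hammingNorm (polarMatrix n i)

/-- The coset with index `i` is non-pre-transformable for the rate-profile `I`: no frozen index
is a later row outside `K_i`. -/
def NonPreTransformable {n : ℕ} (I : Finset (Fin (2 ^ n))) (i : Fin (2 ^ n)) : Prop :=
  Iᶜ ∩ (Finset.Ioi i \ coreRows i) = ∅

/-- The closed-form lower bound on the number of minimum-weight codewords. -/
def lowerBound (r : ℕ) : ℚ := (8 * 2 ^ (3 * r) - 6 * 2 ^ (2 * r) + 2 ^ r) / 3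

end PTPC

namespace PTPC

/-! Every code here is an extended perfect code, whatever `T` is. Upper triangularity keeps the
leading index of a message, and a word whose leading row is `i` has weight at least that of row `i`
(`two_pow_bitWeight_le_hammingNorm`); hence nonzero codewords have weight at least 4. Row 0, the
only row of odd weight, never contributes, so all weights are even. At most n + 1 indices are
frozen, so the packing bound is tight: every odd word is at distance one from the code
(`exists_eq_add_single`). The supports of the weight-4 words therefore form a Steiner quadruple
system: each triple of positions lies in exactly one of them, and their number is C(N,3)/4
(`four_mul_card_weight_four`). For the cosets, a frozen row has weight at most 2 and meets every row
in column 0, which leaves no room for a weight change. -/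

/-! ### Block recursion and weights of the polar transform -/

/-- The index bijection underlying the block structure of the polar matrix. -/
def blockEquiv (n : ℕ) : Fin 2 × Fin (2 ^ n) ≃ Fin (2 ^ (n + 1)) :=
  finProdFinEquiv.trans (finCongr (pow_succ' 2 n).symm)

theorem blockEquiv_val (n : ℕ) (a : Fin 2) (i : Fin (2 ^ n)) :
    (blockEquiv n (a, i) : ℕ) = 2 ^ n * a + i := by
  simp [blockEquiv, finProdFinEquiv, add_comm]

theorem polarMatrix_blockEquiv (n : ℕ) (a b : Fin 2) (i j : Fin (2 ^ n)) :
    polarMatrix (n + 1) (blockEquiv n (a, i)) (blockEquiv n (b, j)) =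
      polarKernel a b * polarMatrix n i j := by
  simp only [polarMatrix, Matrix.reindex_apply, Matrix.submatrix_apply]
  change Matrix.kronecker polarKernel (polarMatrix n)
    ((blockEquiv n).symm (blockEquiv n (a, i))) ((blockEquiv n).symm (blockEquiv n (b, j))) = _
  rw [Equiv.symm_apply_apply, Equiv.symm_apply_apply]
  rfl

theorem vecMul_polarMatrix_blockEquiv (n : ℕ) (u : Fin (2 ^ (n + 1)) → ZMod 2) (b : Fin 2)
    (j : Fin (2 ^ n)) :
    Matrix.vecMul u (polarMatrix (n + 1)) (blockEquiv n (b, j)) =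
      ∑ a, polarKernel a b *
        Matrix.vecMul (fun i => u (blockEquiv n (a, i))) (polarMatrix n) j := by
  simp only [Matrix.vecMul, dotProduct]
  rw [← (blockEquiv n).sum_comp, Fintype.sum_prod_type]
  refine Finset.sum_congr rfl fun a _ => ?_
  rw [Finset.mul_sum]
  refine Finset.sum_congr rfl fun i _ => ?_
  rw [polarMatrix_blockEquiv]
  ring

theorem hammingNorm_eq_sum {ι : Type*} [Fintype ι] (x : ι → ZMod 2) :
    hammingNorm x = ∑ i, if x i ≠ 0 then 1 else 0 := by
  rw [Finset.sum_boole]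
  rfl

theorem hammingNorm_blockEquiv (n : ℕ) (x : Fin (2 ^ (n + 1)) → ZMod 2) :
    hammingNorm x = hammingNorm (fun j => x (blockEquiv n (0, j))) +
      hammingNorm (fun j => x (blockEquiv n (1, j))) := by
  simp only [hammingNorm_eq_sum]
  rw [← (blockEquiv n).sum_comp, Fintype.sum_prod_type, Fin.sum_univ_two]

theorem add_self_eq_zero {ι : Type*} (x : ι → ZMod 2) : x + x = 0 :=
  funext fun _ => CharTwo.add_self_eq_zero _

theorem hammingNorm_add_le {ι : Type*} [Fintype ι] (x y : ι → ZMod 2) :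
    hammingNorm (x + y) ≤ hammingNorm x + hammingNorm y := by
  simp only [hammingNorm_eq_sum, ← Finset.sum_add_distrib]
  refine Finset.sum_le_sum fun i _ => ?_
  rw [Pi.add_apply]
  generalize x i = a
  generalize y i = b
  revert a b
  decide

theorem bitWeight_blockEquiv (n : ℕ) (a : Fin 2) (i : Fin (2 ^ n)) :
    bitWeight (n + 1) (blockEquiv n (a, i)) = a + bitWeight n i := by
  have hlow : ((Finset.range n).filter fun l => (2 ^ n * (a : ℕ) + i).testBit l = true) =
      (Finset.range n).filter fun l => (i : ℕ).testBit l = true := by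
    refine Finset.filter_congr fun l hl => ?_
    rw [Nat.testBit_two_pow_mul_add _ i.2, if_pos (Finset.mem_range.1 hl)]
  have htop : (2 ^ n * (a : ℕ) + i).testBit n = (a : ℕ).testBit 0 := by
    rw [Nat.testBit_two_pow_mul_add _ i.2, if_neg (lt_irrefl n), Nat.sub_self]
  unfold bitWeight
  rw [blockEquiv_val, Finset.range_add_one, Finset.filter_insert, htop, hlow]
  fin_cases a
  · simp
  · simp [add_comm]

/-- Plotkin induction: if the halves of u transform to x₀ and x₁, then u transforms to (x₀ + x₁,
x₁). A leading index in the upper half forces x₀ = 0, so x₁ occurs twice; otherwise w(x₀ + x₁) +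
w(x₁) ≥ w(x₀). -/
theorem two_pow_bitWeight_le_hammingNorm (n : ℕ) :
    ∀ (u : Fin (2 ^ n) → ZMod 2) (i : Fin (2 ^ n)), (∀ j < i, u j = 0) → u i ≠ 0 →
      2 ^ bitWeight n i ≤ hammingNorm (Matrix.vecMul u (polarMatrix n)) := by
  induction n with
  | zero =>
    intro u i _ hi
    have hne : Matrix.vecMul u (polarMatrix 0) ≠ 0 := by
      simp only [polarMatrix, Matrix.vecMul_one]
      exact fun h => hi (congrFun h i)
    simpa [bitWeight] using Nat.one_le_iff_ne_zero.2 (hammingNorm_ne_zero_iff.2 hne)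
  | succ n ih =>
    intro u i hlt hi
    obtain ⟨⟨a, i⟩, rfl⟩ := (blockEquiv n).surjective i
    set u₀ : Fin (2 ^ n) → ZMod 2 := fun i => u (blockEquiv n (0, i)) with hu₀
    set u₁ : Fin (2 ^ n) → ZMod 2 := fun i => u (blockEquiv n (1, i)) with hu₁
    rw [hammingNorm_blockEquiv, bitWeight_blockEquiv]
    have h0 : (fun j => Matrix.vecMul u (polarMatrix (n + 1)) (blockEquiv n (0, j))) =
        Matrix.vecMul u₀ (polarMatrix n) + Matrix.vecMul u₁ (polarMatrix n) := by
      funext j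
      rw [vecMul_polarMatrix_blockEquiv, Fin.sum_univ_two]
      simp [polarKernel, hu₀, hu₁]
    have h1 : (fun j => Matrix.vecMul u (polarMatrix (n + 1)) (blockEquiv n (1, j))) =
        Matrix.vecMul u₁ (polarMatrix n) := by
      funext j
      rw [vecMul_polarMatrix_blockEquiv, Fin.sum_univ_two]
      simp [polarKernel, hu₁]
    rw [h0, h1]
    have hlt' : ∀ j < i, u (blockEquiv n (a, j)) = 0 := fun j hj => hlt _ (by
      rw [Fin.lt_def, blockEquiv_val, blockEquiv_val]
      exact Nat.add_lt_add_left hj _)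
    have hle := ih _ i hlt' hi
    fin_cases a
    · have hadd := hammingNorm_add_le
        (Matrix.vecMul u₀ (polarMatrix n) + Matrix.vecMul u₁ (polarMatrix n))
        (Matrix.vecMul u₁ (polarMatrix n))
      rw [add_assoc, PTPC.add_self_eq_zero, add_zero] at hadd
      simpa using hle.trans hadd
    · have hz : u₀ = 0 := by
        funext j
        refine hlt _ ?_
        rw [Fin.lt_def, blockEquiv_val, blockEquiv_val]
        simp
        omega
      have hle' : 2 ^ bitWeight n i ≤ hammingNorm (Matrix.vecMul u₁ (polarMatrix n)) := hle
      rw [hz, Matrix.zero_vecMul, zero_add]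
      simp only [pow_add, pow_one]
      omega

theorem hammingNorm_polarMatrix (n : ℕ) (i : Fin (2 ^ n)) :
    hammingNorm (polarMatrix n i) = 2 ^ bitWeight n i := by
  induction n with
  | zero =>
    obtain rfl : i = 0 := by
      rw [Fin.ext_iff]
      simp
    rfl
  | succ n ih =>
    obtain ⟨⟨a, i⟩, rfl⟩ := (blockEquiv n).surjective i
    rw [hammingNorm_blockEquiv, bitWeight_blockEquiv]
    simp only [polarMatrix_blockEquiv]
    have h := ih i
    have hz : hammingNorm (fun _ : Fin (2 ^ n) => (0 : ZMod 2)) = 0 := hammingNorm_zero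
    fin_cases a
    · simpa [polarKernel, hz] using h
    · simp only [polarKernel, Fin.mk_one, Matrix.of_apply, Matrix.cons_val_one,
        Matrix.cons_val_zero, Matrix.cons_val_fin_one, one_mul, pow_add, pow_one]
      have h' : hammingNorm (fun j => polarMatrix n i j) = 2 ^ bitWeight n i := h
      omega

/-- Used to make any two rows overlap in at least one position. -/
theorem polarMatrix_apply_zero (n : ℕ) (i : Fin (2 ^ n)) : polarMatrix n i 0 = 1 := by
  induction n with
  | zero =>
    obtain rfl : i = 0 := by
      rw [Fin.ext_iff]
      simp
    rfl
  | succ n ih =>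
    obtain ⟨⟨a, i⟩, rfl⟩ := (blockEquiv n).surjective i
    have h0 : (0 : Fin (2 ^ (n + 1))) = blockEquiv n (0, 0) := by
      rw [Fin.ext_iff, blockEquiv_val]
      simp
    rw [h0, polarMatrix_blockEquiv, ih]
    fin_cases a <;> rfl

/-! ### Size of the rate-profile -/

theorem eq_of_bitWeight_le_one {n : ℕ} {f : Fin (2 ^ n)} (hf : bitWeight n f ≤ 1) :
    (f : ℕ) = 0 ∨ ∃ k < n, (f : ℕ) = 2 ^ k := by
  have hbit : ∀ l, (f : ℕ).testBit l = true → l < n := fun l hl => by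
    by_contra! h
    rw [Nat.testBit_lt_two_pow (f.2.trans_le (Nat.pow_le_pow_right two_pos h))] at hl
    exact Bool.false_ne_true hl
  by_cases h0 : (f : ℕ) = 0
  · exact Or.inl h0
  obtain ⟨k, hk⟩ := Nat.exists_testBit_of_ne_zero h0
  refine Or.inr ⟨k, hbit k hk, Nat.eq_of_testBit_eq fun l => ?_⟩
  rw [Nat.testBit_two_pow, Bool.eq_iff_iff, decide_eq_true_iff]
  refine ⟨fun hl => ?_, fun h => h ▸ hk⟩
  exact Finset.card_le_one.1 hf k (by simp [hk, hbit]) l (by simp [hl, hbit])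

theorem card_bitWeight_le_one (n : ℕ) :
    (Finset.univ.filter fun f : Fin (2 ^ n) => bitWeight n f ≤ 1).card ≤ n + 1 := by
  have hsub : (Finset.univ.filter fun f : Fin (2 ^ n) => bitWeight n f ≤ 1).image Fin.val ⊆
      insert 0 ((Finset.range n).image (2 ^ ·)) := by
    intro m hm
    obtain ⟨f, hf, rfl⟩ := Finset.mem_image.1 hm
    rcases eq_of_bitWeight_le_one (Finset.mem_filter.1 hf).2 with h | ⟨k, hk, h⟩
    · simp [h]
    · simp only [Finset.mem_insert, Finset.mem_image, Finset.mem_range]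
      exact Or.inr ⟨k, hk, h.symm⟩
  rw [← Finset.card_image_of_injective _ Fin.val_injective]
  refine (Finset.card_le_card hsub).trans ((Finset.card_insert_le _ _).trans ?_)
  simpa using (Finset.card_image_le (s := Finset.range n) (f := (2 ^ ·)))

theorem mem_rmProfile {r n : ℕ} (hr : n = r + 2) {i : Fin (2 ^ n)} :
    i ∈ rmProfile r n ↔ 2 ≤ bitWeight n i := by
  simp only [rmProfile, Finset.mem_filter, Finset.mem_univ, true_and]
  omega

theorem two_pow_le_card_rmProfile {r n : ℕ} (hr : n = r + 2) :
    2 ^ n ≤ (rmProfile r n).card + (n + 1) := by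
  have h := Finset.card_add_card_compl (rmProfile r n)
  have hc : (rmProfile r n)ᶜ = Finset.univ.filter fun f : Fin (2 ^ n) => bitWeight n f ≤ 1 := by
    ext f
    simp only [Finset.mem_compl, mem_rmProfile hr, Finset.mem_filter, Finset.mem_univ, true_and]
    omega
  rw [hc, Fintype.card_fin] at h
  have := card_bitWeight_le_one n
  omega

/-! ### Parity of transformed words -/

theorem sum_eq_hammingNorm {ι : Type*} [Fintype ι] (x : ι → ZMod 2) :
    ∑ i, x i = (hammingNorm x : ZMod 2) := by
  rw [hammingNorm_eq_sum, Nat.cast_sum]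
  refine Finset.sum_congr rfl fun i _ => ?_
  generalize x i = a
  revert a
  decide

theorem bitWeight_ne_zero {n : ℕ} {i : Fin (2 ^ n)} (hi : i ≠ 0) : bitWeight n i ≠ 0 := by
  intro h
  obtain ⟨k, hk⟩ := Nat.exists_testBit_of_ne_zero (Fin.val_ne_zero_iff.2 hi)
  have hkn : k < n := by
    by_contra! h
    rw [Nat.testBit_lt_two_pow (i.2.trans_le (Nat.pow_le_pow_right two_pos h))] at hk
    exact Bool.false_ne_true hk
  exact Finset.notMem_empty k (Finset.card_eq_zero.1 h ▸
    Finset.mem_filter.2 ⟨Finset.mem_range.2 hkn, hk⟩)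

/-- Words without a component at the row of odd weight have even weight. -/
theorem sum_vecMul_polarMatrix {n : ℕ} {u : Fin (2 ^ n) → ZMod 2} (hu : u 0 = 0) :
    ∑ j, Matrix.vecMul u (polarMatrix n) j = 0 := by
  simp only [Matrix.vecMul, dotProduct]
  rw [Finset.sum_comm]
  refine Finset.sum_eq_zero fun i _ => ?_
  rw [← Finset.mul_sum]
  by_cases hi : i = 0
  · rw [hi, hu, zero_mul]
  · rw [sum_eq_hammingNorm, hammingNorm_polarMatrix, Nat.cast_pow]
    rw [show ((2 : ℕ) : ZMod 2) = 0 from rfl, zero_pow (bitWeight_ne_zero hi), mul_zero]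

theorem hammingNorm_single_le {ι : Type*} [Fintype ι] [DecidableEq ι] (j : ι) (a : ZMod 2) :
    hammingNorm (Pi.single j a : ι → ZMod 2) ≤ 1 := by
  unfold hammingNorm
  refine Finset.card_le_one.2 fun k hk l hl => ?_
  simp only [Finset.mem_filter, Pi.single_apply, Finset.mem_univ, true_and] at hk hl
  rw [show k = j by by_contra h; simp [h] at hk, show l = j by by_contra h; simp [h] at hl]

/-! ### Extended perfect codes and quadruple systems -/

section ExtendedPerfect

variable {ι : Type*} [Fintype ι] (C : AddSubgroup (ι → ZMod 2))

theorem eq_of_hammingNorm_add_lt {w : ℕ} (hmin : ∀ c ∈ C, c ≠ 0 → w ≤ hammingNorm c)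
    {c c' : ι → ZMod 2} (hc : c ∈ C) (hc' : c' ∈ C) (h : hammingNorm (c + c') < w) : c = c' := by
  by_contra hne
  refine absurd (hmin _ (C.add_mem hc hc') fun h0 => hne ?_) (not_le.2 h)
  exact add_right_cancel (h0.trans (PTPC.add_self_eq_zero c').symm)

/-- In an even code of minimum weight at least four with at least `2 ^ |ι| / (2 |ι|)` words,
every word of odd weight is at distance one from a codeword. -/
theorem exists_eq_add_single [DecidableEq ι] [Nonempty ι] (hmin : ∀ c ∈ C, c ≠ 0 → 4 ≤ hammingNorm c)
    (heven : ∀ c ∈ C, ∑ i, c i = 0)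
    (hcard : 2 ^ Fintype.card ι ≤ Nat.card C * (Fintype.card ι * 2))
    (x : ι → ZMod 2) (hx : ∑ i, x i = 1) : ∃ c ∈ C, ∃ j, x = c + Pi.single j 1 := by
  classical
  obtain ⟨i₀⟩ := ‹Nonempty ι›
  -- Disjoint radius-one spheres around codewords give odd words; the bit at the fixed position `i₀`
  -- shifts them to even words as well, so an injective `F` fills the whole space by counting.
  let F : C × ι × ZMod 2 → (ι → ZMod 2) :=
    fun p => (p.1 : ι → ZMod 2) + Pi.single p.2.1 1 + Pi.single i₀ p.2.2
  have hsum : ∀ p, ∑ i, F p i = 1 + p.2.2 := by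
    rintro ⟨c, j, b⟩
    simp [F, Finset.sum_add_distrib, heven c c.2]
  have hinj : Function.Injective F := by
    rintro ⟨⟨c, hc⟩, j, b⟩ ⟨⟨c', hc'⟩, j', b'⟩ h
    have hb : b = b' := by
      have := (hsum ⟨⟨c, hc⟩, j, b⟩).symm.trans ((congrArg (fun y => ∑ i, y i) h).trans
        (hsum ⟨⟨c', hc'⟩, j', b'⟩))
      exact add_left_cancel this
    subst hb
    have h1 : c + Pi.single j 1 = c' + Pi.single j' 1 := add_right_cancel h
    have h2 : c + c' = Pi.single j 1 + Pi.single j' 1 := by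
      refine add_right_cancel (b := c' + Pi.single j 1) ?_
      calc c + c' + (c' + Pi.single j 1) = c + Pi.single j 1 + (c' + c') := by abel
        _ = c' + Pi.single j' 1 + (Pi.single j 1 + Pi.single j 1) := by
          rw [h1, PTPC.add_self_eq_zero, PTPC.add_self_eq_zero]
        _ = Pi.single j 1 + Pi.single j' 1 + (c' + Pi.single j 1) := by abel
    -- The two codewords differ in at most two positions, fewer than four.
    have hcc : c = c' := by
      refine eq_of_hammingNorm_add_lt C hmin hc hc' ?_
      rw [h2]
      have := hammingNorm_add_le (Pi.single j 1 : ι → ZMod 2) (Pi.single j' 1)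
      have := hammingNorm_single_le j (1 : ZMod 2)
      have := hammingNorm_single_le j' (1 : ZMod 2)
      omega
    subst hcc
    have h3 : (Pi.single j 1 : ι → ZMod 2) = Pi.single j' 1 := add_left_cancel h1
    have hj : j = j' := by
      by_contra hne
      have := congrFun h3 j
      simp [hne] at this
    subst hj
    rfl
  have hbij : Function.Bijective F := by
    refine hinj.bijective_of_nat_card_le ?_
    rw [Nat.card_prod, Nat.card_prod, Nat.card_eq_fintype_card (α := ι → ZMod 2),
      Nat.card_eq_fintype_card (α := ι), Nat.card_eq_fintype_card (α := ZMod 2), Fintype.card_fun,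
      ZMod.card]
    exact hcard
  obtain ⟨⟨⟨c, hc⟩, j, b⟩, h⟩ := hbij.surjective x
  have hb : b = 0 := by
    have := hsum ⟨⟨c, hc⟩, j, b⟩
    rw [h, hx] at this
    simpa using this
  subst hb
  exact ⟨c, hc, j, by simpa [F] using h.symm⟩

/-- The codewords of weight four of an extended perfect code form a Steiner quadruple system. -/
theorem four_mul_card_weight_four [Nonempty ι] (hmin : ∀ c ∈ C, c ≠ 0 → 4 ≤ hammingNorm c)
    (heven : ∀ c ∈ C, ∑ i, c i = 0)
    (hcard : 2 ^ Fintype.card ι ≤ Nat.card C * (Fintype.card ι * 2)) :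
    4 * {c | c ∈ C ∧ hammingNorm c = 4}.ncard = (Fintype.card ι).choose 3 := by
  classical
  let supp : (ι → ZMod 2) → Finset ι := fun c => Finset.univ.filter fun i => c i ≠ 0
  have hsupp : ∀ c, (supp c).card = hammingNorm c := fun _ => rfl
  let B : Finset (ι → ZMod 2) := Finset.univ.filter fun c => c ∈ C ∧ hammingNorm c = 4
  have hB : {c | c ∈ C ∧ hammingNorm c = 4} = (B : Set (ι → ZMod 2)) := by
    ext c
    simp [B]
  have hmemB : ∀ {c}, c ∈ B ↔ c ∈ C ∧ hammingNorm c = 4 := by simp [B]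
  have hdisj : (B : Set (ι → ZMod 2)).PairwiseDisjoint fun c => (supp c).powersetCard 3 := by
    intro c hc c' hc' hne
    refine Finset.disjoint_left.2 fun S hS hS' => hne ?_
    obtain ⟨hS, hS3⟩ := Finset.mem_powersetCard.1 hS
    obtain ⟨hS', -⟩ := Finset.mem_powersetCard.1 hS'
    have hc := hmemB.1 (Finset.mem_coe.1 hc)
    have hc' := hmemB.1 (Finset.mem_coe.1 hc')
    refine eq_of_hammingNorm_add_lt C hmin hc.1 hc'.1 ?_
    -- Two weight-4 words sharing a triple cancel on it, leaving weight at most 1 + 1.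
    have hsub : supp (c + c') ⊆ (supp c \ S) ∪ (supp c' \ S) := by
      intro i hi
      have hS1 : i ∈ S → c i ≠ 0 := fun h => (Finset.mem_filter.1 (hS h)).2
      have hS2 : i ∈ S → c' i ≠ 0 := fun h => (Finset.mem_filter.1 (hS' h)).2
      simp only [supp, Finset.mem_filter, Finset.mem_univ, true_and, Finset.mem_union,
        Finset.mem_sdiff, Pi.add_apply] at hi ⊢
      revert hi hS1 hS2
      by_cases h : i ∈ S <;> simp only [h, forall_true_left, false_imp_iff, not_true_eq_false,
        not_false_eq_true, and_true, and_false] <;>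
      · generalize c i = a
        generalize c' i = b
        revert a b
        decide
    rw [← hsupp]
    refine (Finset.card_le_card hsub).trans_lt ((Finset.card_union_le _ _).trans_lt ?_)
    rw [Finset.card_sdiff_of_subset hS, Finset.card_sdiff_of_subset hS', hsupp, hsupp, hc.2,
      hc'.2, hS3]
    norm_num
  have hunion : B.biUnion (fun c => (supp c).powersetCard 3) =
      (Finset.univ : Finset ι).powersetCard 3 := by
    refine Finset.Subset.antisymm (Finset.biUnion_subset.2 fun c _ =>
      Finset.powersetCard_mono (Finset.subset_univ _)) fun S hS => ?_
    obtain ⟨-, hS3⟩ := Finset.mem_powersetCard.1 hS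
    -- The indicator of a triple has odd weight, so one flip makes it a codeword; that flip must add
    -- a fourth point.
    let x : ι → ZMod 2 := fun i => if i ∈ S then 1 else 0
    have hx : ∑ i, x i = 1 := by
      simp only [x, Finset.sum_boole, Finset.filter_mem_eq_inter, Finset.univ_inter, hS3]
      rfl
    have hxs : supp x = S := by
      ext i
      simp [supp, x]
    obtain ⟨c, hc, j, hxc⟩ := exists_eq_add_single C hmin heven hcard x hx
    have hcx : c = x + Pi.single j 1 := by
      rw [hxc, add_assoc, CharTwo.add_self_eq_zero, add_zero]
    have hj : j ∉ S := by
      -- Flipping inside the triple would leave a codeword of weight 2.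
      intro hj
      have hsub : supp c = S.erase j := by
        ext i
        by_cases hi : i = j
        · subst hi
          simp [supp, hcx, x, hj, CharTwo.add_self_eq_zero]
        · simp [supp, hcx, x, hi]
      have hw : hammingNorm c = 2 := by
        rw [← hsupp, hsub, Finset.card_erase_of_mem hj, hS3]
      have h0 : c ≠ 0 := by
        rintro rfl
        simp at hw
      have := hmin c hc h0
      omega
    have hsub : supp c = insert j S := by
      ext i
      by_cases hi : i = j
      · subst hi
        simp [supp, hcx, x, hj]
      · simp [supp, hcx, x, hi]
    refine Finset.mem_biUnion.2 ⟨c, hmemB.2 ⟨hc, ?_⟩, Finset.mem_powersetCard.2 ⟨?_, hS3⟩⟩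
    · rw [← hsupp, hsub, Finset.card_insert_of_notMem hj, hS3]
    · rw [hsub]
      exact Finset.subset_insert _ _
  have hcount := Finset.card_biUnion hdisj
  rw [hunion, Finset.card_powersetCard, Finset.card_univ] at hcount
  -- Each block of four points contains exactly four triples.
  rw [hB, Set.ncard_coe_finset, hcount, Finset.sum_const_nat (m := 4), mul_comm]
  intro c hc
  rw [Finset.card_powersetCard, hsupp, (hmemB.1 hc).2]
  rfl

end ExtendedPerfect

/-! ### The pre-transformed code is extended perfect -/

/-- The pre-transformed code as an additive group. -/
def codeSubgroup {n : ℕ} (I : Finset (Fin (2 ^ n)))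
    (T : Matrix (Fin (2 ^ n)) (Fin (2 ^ n)) (ZMod 2)) : AddSubgroup (Fin (2 ^ n) → ZMod 2) where
  carrier := code I T
  zero_mem' := ⟨0, by simp, by simp⟩
  add_mem' := by
    rintro _ _ ⟨v, hv, rfl⟩ ⟨w, hw, rfl⟩
    exact ⟨v + w, fun f hf => by simp [hv f hf, hw f hf], by simp [Matrix.add_vecMul]⟩
  neg_mem' := by
    rintro _ ⟨v, hv, rfl⟩
    exact ⟨-v, fun f hf => by simp [hv f hf], by simp [Matrix.neg_vecMul]⟩

/-- The smallest index of the support is preserved by a pre-transformation. -/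
theorem exists_lead_vecMul {n : ℕ} {I : Finset (Fin (2 ^ n))}
    {T : Matrix (Fin (2 ^ n)) (Fin (2 ^ n)) (ZMod 2)} (hT : IsPreTransform I T)
    {v : Fin (2 ^ n) → ZMod 2} (hv : ∀ f, f ∉ I → v f = 0) (hv0 : v ≠ 0) :
    ∃ i ∈ I, (∀ j < i, Matrix.vecMul v T j = 0) ∧ Matrix.vecMul v T i ≠ 0 := by
  obtain ⟨k, hk⟩ := Function.ne_iff.1 hv0
  obtain ⟨i, hi, hmin⟩ := (Finset.univ.filter fun i => v i ≠ 0).exists_minimal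
    ⟨k, by simpa using hk⟩
  have hi0 : v i ≠ 0 := (Finset.mem_filter.1 hi).2
  have hlow : ∀ j < i, v j = 0 := fun j hj => by
    by_contra h
    exact absurd (hmin (Finset.mem_filter.2 ⟨Finset.mem_univ j, h⟩) hj.le) (not_le.2 hj)
  have hiI : i ∈ I := by
    by_contra h
    exact hi0 (hv i h)
  refine ⟨i, hiI, fun j hj => ?_, ?_⟩
  · simp only [Matrix.vecMul, dotProduct]
    refine Finset.sum_eq_zero fun k _ => ?_
    rcases lt_or_ge k i with h | h
    · rw [hlow k h, zero_mul]
    · rw [hT.1 k j (hj.trans_le h), mul_zero]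
  · have : Matrix.vecMul v T i = v i := by
      simp only [Matrix.vecMul, dotProduct]
      refine (Finset.sum_eq_single i (fun k _ hk => ?_)
        fun h => (h (Finset.mem_univ i)).elim).trans ?_
      · rcases lt_or_gt_of_ne hk with h | h
        · rw [hlow k h, zero_mul]
        · rw [hT.1 k i h, mul_zero]
      · rw [hT.2 i hiI, mul_one]
    rwa [this]

theorem four_le_hammingNorm_vecMul {r n : ℕ} (hr : n = r + 2)
    {T : Matrix (Fin (2 ^ n)) (Fin (2 ^ n)) (ZMod 2)} (hT : IsPreTransform (rmProfile r n) T)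
    {v : Fin (2 ^ n) → ZMod 2} (hv : ∀ f, f ∉ rmProfile r n → v f = 0) (hv0 : v ≠ 0) :
    4 ≤ hammingNorm (Matrix.vecMul (Matrix.vecMul v T) (polarMatrix n)) := by
  obtain ⟨i, hiI, hlow, hi⟩ := exists_lead_vecMul hT hv hv0
  refine le_trans ?_ (two_pow_bitWeight_le_hammingNorm n _ i hlow hi)
  exact Nat.pow_le_pow_right two_pos ((mem_rmProfile hr).1 hiI)

theorem four_le_hammingNorm_of_mem_code {r n : ℕ} (hr : n = r + 2)
    {T : Matrix (Fin (2 ^ n)) (Fin (2 ^ n)) (ZMod 2)} (hT : IsPreTransform (rmProfile r n) T) :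
    ∀ c ∈ codeSubgroup (rmProfile r n) T, c ≠ 0 → 4 ≤ hammingNorm c := by
  rintro _ ⟨v, hv, rfl⟩ hc
  refine four_le_hammingNorm_vecMul hr hT hv ?_
  rintro rfl
  simp at hc

theorem sum_eq_zero_of_mem_code {r n : ℕ} (hr : n = r + 2)
    {T : Matrix (Fin (2 ^ n)) (Fin (2 ^ n)) (ZMod 2)} (hT : IsPreTransform (rmProfile r n) T) :
    ∀ c ∈ codeSubgroup (rmProfile r n) T, ∑ i, c i = 0 := by
  rintro _ ⟨v, hv, rfl⟩
  refine sum_vecMul_polarMatrix ?_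
  simp only [Matrix.vecMul, dotProduct]
  refine Finset.sum_eq_zero fun i _ => ?_
  -- Index 0 is frozen, and column 0 of `T` vanishes below the diagonal, so coordinate 0 of vT is
  -- zero.
  by_cases hi : i = 0
  · have h0 : i ∉ rmProfile r n := by
      rw [mem_rmProfile hr, hi]
      simp [bitWeight]
    rw [hv i h0, zero_mul]
  · rw [hT.1 i 0 (Fin.pos_iff_ne_zero.2 hi), mul_zero]

/-- Encoding is injective because a nonzero message already yields weight at least 4; no separate
rank argument is needed. -/
theorem two_pow_card_le_card_code {r n : ℕ} (hr : n = r + 2)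
    {T : Matrix (Fin (2 ^ n)) (Fin (2 ^ n)) (ZMod 2)} (hT : IsPreTransform (rmProfile r n) T) :
    2 ^ (rmProfile r n).card ≤ Nat.card (codeSubgroup (rmProfile r n) T) := by
  classical
  let E : (rmProfile r n → ZMod 2) → Fin (2 ^ n) → ZMod 2 :=
    fun v i => if h : i ∈ rmProfile r n then v ⟨i, h⟩ else 0
  have hE : ∀ v f, f ∉ rmProfile r n → E v f = 0 := fun v f hf => dif_neg hf
  let F : (rmProfile r n → ZMod 2) → codeSubgroup (rmProfile r n) T :=
    fun v => ⟨_, E v, hE v, rfl⟩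
  have hinj : Function.Injective F := by
    intro v w h
    have h' : Matrix.vecMul (Matrix.vecMul (E v - E w) T) (polarMatrix n) = 0 := by
      rw [Matrix.sub_vecMul, Matrix.sub_vecMul, sub_eq_zero]
      exact congrArg Subtype.val h
    have h0 : E v - E w = 0 := by
      by_contra hne
      have := four_le_hammingNorm_vecMul hr hT
        (fun f hf => by rw [Pi.sub_apply, hE v f hf, hE w f hf, sub_zero]) hne
      rw [h', hammingNorm_zero] at this
      omega
    funext ⟨i, hi⟩
    have := congrFun (sub_eq_zero.1 h0) i
    simpa [E, hi] using this
  have := Nat.card_le_card_of_injective F hinj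
  simpa using this

theorem four_mul_weightCount_code {r n : ℕ} (hr : n = r + 2)
    {T : Matrix (Fin (2 ^ n)) (Fin (2 ^ n)) (ZMod 2)} (hT : IsPreTransform (rmProfile r n) T) :
    4 * weightCount (code (rmProfile r n) T) 4 = (2 ^ n).choose 3 := by
  have h := four_mul_card_weight_four (codeSubgroup (rmProfile r n) T)
    (four_le_hammingNorm_of_mem_code hr hT) (sum_eq_zero_of_mem_code hr hT) (by
      rw [Fintype.card_fin]
      calc 2 ^ 2 ^ n ≤ 2 ^ ((rmProfile r n).card + (n + 1)) :=
            Nat.pow_le_pow_right two_pos (two_pow_le_card_rmProfile hr)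
        _ = 2 ^ (rmProfile r n).card * (2 ^ n * 2) := by rw [pow_add, pow_succ 2 n]
        _ ≤ _ := Nat.mul_le_mul_right _ (two_pow_card_le_card_code hr hT))
  rwa [Fintype.card_fin] at h

theorem minDist_code {r n : ℕ} (hr : n = r + 2)
    {T : Matrix (Fin (2 ^ n)) (Fin (2 ^ n)) (ZMod 2)} (hT : IsPreTransform (rmProfile r n) T) :
    minDist (code (rmProfile r n) T) = 4 := by
  -- The distance is attained because the count of weight-4 words is positive.
  have hne : {c ∈ code (rmProfile r n) T | hammingNorm c = 4}.Nonempty := by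
    rw [← Set.ncard_pos]
    have h := four_mul_weightCount_code hr hT
    have hpos : 0 < (2 ^ n).choose 3 := Nat.choose_pos (by
      have : 2 ^ 2 ≤ 2 ^ n := Nat.pow_le_pow_right two_pos (by omega)
      omega)
    unfold weightCount at h
    omega
  obtain ⟨c, hc, hc4⟩ := hne
  refine IsLeast.csInf_eq ⟨⟨c, hc, 0, (codeSubgroup _ T).zero_mem, ?_, ?_⟩, ?_⟩
  · rintro rfl
    simp at hc4
  · rw [hammingDist_zero_right, hc4]
  · rintro _ ⟨c, hc, c', hc', hne, rfl⟩
    rw [hammingDist_eq_hammingNorm]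
    refine four_le_hammingNorm_of_mem_code hr hT _
      ((codeSubgroup _ T).add_mem ((codeSubgroup _ T).neg_mem hc) hc') fun h => hne ?_
    exact (neg_add_eq_zero.1 h)

theorem weightCount_code {r n : ℕ} (hr : n = r + 2)
    {T : Matrix (Fin (2 ^ n)) (Fin (2 ^ n)) (ZMod 2)} (hT : IsPreTransform (rmProfile r n) T) :
    (weightCount (code (rmProfile r n) T) 4 : ℚ) = lowerBound r := by
  have h : (4 * weightCount (code (rmProfile r n) T) 4 : ℚ) = ((2 ^ n).choose 3 : ℕ) := by
    exact_mod_cast four_mul_weightCount_code hr hT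
  have hN : 1 ≤ 2 ^ r := Nat.one_le_two_pow
  -- Over ℚ the binomial is N(N-1)(N-2)/6; with N = 4 · 2^r the claim is a polynomial identity in
  -- 2^r.
  rw [Nat.cast_choose_eq_descPochhammer_div] at h
  simp only [descPochhammer_succ_right, descPochhammer_zero] at h
  subst hr
  simp [Nat.factorial, pow_add] at h
  rw [lowerBound, mul_comm 3 r, mul_comm 2 r, pow_mul, pow_mul]
  linarith

/-! ### Minimum-weight cosets -/

/-- Two words with a common support position. -/
theorem hammingNorm_add_add_two_le {ι : Type*} [Fintype ι] [DecidableEq ι] {x y : ι → ZMod 2}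
    {i : ι} (hx : x i = 1) (hy : y i = 1) :
    hammingNorm (x + y) + 2 ≤ hammingNorm x + hammingNorm y := by
  simp only [hammingNorm_eq_sum, ← Finset.sum_add_distrib]
  rw [← Finset.add_sum_erase _ _ (Finset.mem_univ i),
    ← Finset.add_sum_erase _ (fun j => (if x j ≠ 0 then 1 else 0) + if y j ≠ 0 then 1 else 0)
      (Finset.mem_univ i)]
  have hle : ∑ j ∈ Finset.univ.erase i, (if (x + y) j ≠ 0 then 1 else 0) ≤
      ∑ j ∈ Finset.univ.erase i, ((if x j ≠ 0 then 1 else 0) + if y j ≠ 0 then 1 else 0) := by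
    refine Finset.sum_le_sum fun j _ => ?_
    rw [Pi.add_apply]
    generalize x j = a
    generalize y j = b
    revert a b
    decide
  simp only [Pi.add_apply, hx, hy, CharTwo.add_self_eq_zero] at hle ⊢
  simp only [ne_eq, not_true_eq_false, one_ne_zero, not_false_eq_true, if_true, if_false]
  simp only [ne_eq] at hle
  omega

/-- A frozen row has weight at most 2 and shares column 0 with row `i`, so the sum has weight at
most 4 + 2 - 2. The reverse inequality is the leading-row bound, since `i` remains the leading index
of the sum. -/
theorem nonPreTransformable_rmProfile {r n : ℕ} (hr : n = r + 2) {i : Fin (2 ^ n)}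
    (hi : i ∈ leaderIndices (rmProfile r n) 4) : NonPreTransformable (rmProfile r n) i := by
  have hi4 : hammingNorm (polarMatrix n i) = 4 := (Finset.mem_filter.1 hi).2
  refine Finset.eq_empty_of_forall_notMem fun f hf => ?_
  rw [Finset.mem_inter, Finset.mem_compl, Finset.mem_sdiff, coreRows, Finset.mem_filter,
    mem_rmProfile hr, not_le] at hf
  obtain ⟨hfI, hif, hf⟩ := hf
  refine hf ⟨hif, le_antisymm ?_ ?_⟩
  · have h := hammingNorm_add_add_two_le (polarMatrix_apply_zero n i) (polarMatrix_apply_zero n f)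
    have h2 : hammingNorm (polarMatrix n f) ≤ 2 ^ 1 := by
      rw [hammingNorm_polarMatrix]
      exact Nat.pow_le_pow_right two_pos (by omega)
    omega
  · have hlt := Finset.mem_Ioi.1 hif
    have h := two_pow_bitWeight_le_hammingNorm n (Pi.single i 1 + Pi.single f 1) i
      (fun j hj => by simp [hj.ne, (hj.trans hlt).ne]) (by simp [hlt.ne])
    rw [Matrix.add_vecMul, Matrix.single_one_vecMul, Matrix.single_one_vecMul,
      ← hammingNorm_polarMatrix] at h
    exact h

end PTPC

theorem mainTheorem4 (r n : ℕ) (hr : n = r + 2)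
    (T : Matrix (Fin (2 ^ n)) (Fin (2 ^ n)) (ZMod 2))
    (hT : PTPC.IsPreTransform (PTPC.rmProfile r n) T) :
    PTPC.minDist (PTPC.code (PTPC.rmProfile r n) T) = 2 ^ (n - r) ∧
    (PTPC.weightCount (PTPC.code (PTPC.rmProfile r n) T)
        (PTPC.minDist (PTPC.code (PTPC.rmProfile r n) T)) : ℚ) = PTPC.lowerBound r ∧
    ∀ i ∈ PTPC.leaderIndices (PTPC.rmProfile r n)
        (PTPC.minDist (PTPC.code (PTPC.rmProfile r n) T)),
      PTPC.NonPreTransformable (PTPC.rmProfile r n) i := by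
  rw [PTPC.minDist_code hr hT]
  refine ⟨?_, PTPC.weightCount_code hr hT, fun i hi => PTPC.nonPreTransformable_rmProfile hr hi⟩
  rw [hr, Nat.add_sub_cancel_left]
  norm_num
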